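/- \textbf{Conventions.} All Hilbert spaces are finite-dimensional and complex. A \emph{quantum graph} is a pair $(A,\Gamma)$ of a special symmetric dagger Frobenius algebra $A$ (a Hilbert space with an associative unital multiplication $m:A\otimes A\to A$, unit $u\in A$, such that $(1\otimes m)(m^\dagger\otimes 1)=m^\dagger m=(m\otimes 1)(1\otimes m^\dagger)$, $mm^\dagger=1$ and $\langle u,m(a\otimes b)\rangle=\langle u,m(b\otimes a)\rangle$) and a self-adjoint linear map $\Gamma:A\to A$ with $m(\Gamma\otimes\Gamma)m^\dagger=\Gamma$, $(1\otimes \mathrm{cap})(1\otimes\Gamma\otimes 1)(\mathrm{cup}\otimes 1)=\Gamma$ and $m(\Gamma\otimes 1)m^\dagger=1$, where $\mathrm{cup}=m^\dagger(u)$ and $\mathrm{cap}=\langle u,m(-)\rangle$. It is \emph{classical} if $A$ is commutative. A classical graph $\Gamma$ is a finite undirected graph with vertex set $V_\Gamma$ in which every vertex is adjacent to itself, with adjacency matrix $(\Gamma_{v,w})$; $\mathrm{Aut}(\Gamma)$ is its automorphism group. A \emph{subgroup of central type} $(L,\psi)$ of $\mathrm{Aut}(\Gamma)$ is a subgroup $L$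 with a 2-cocycle $\psi:L\times L\to U(1)$ whose twisted group algebra $\mathbb{C}L^\psi$ (basis $L$, product $a\star b=\psi(a,b)\,ab$) is simple. Put $\rho_\psi(a,b)=\psi(a,b)\,\overline{\psi(aba^{-1},a)}$, and for $S\subseteq L$ let $S^\perp=\{a\in L \mid \rho_\psi(a,b)=1 \text{ for all } b\in S \text{ with } ab=ba\}$; $S$ is \emph{coisotropic} if $S^\perp\subseteq S$. A \emph{nice unitary error basis} for $(L,\psi)$ is a family of unitaries $U_a$ ($a\in L$) on $H=\mathbb{C}^n$ with $|L|=n^2$, $\mathrm{Tr}(U_a^\dagger U_b)=n\,\delta_{a,b}$ and $U_aU_b=\psi(a,b)U_{ab}$. \textbf{The quantum graph $\Gamma_{L,\psi}$.} Let $V_\Gamma$ also denote the Hilbert space with orthonormal basis $\{|v\rangle\}$, on which $L$ acts by $a|v\rangle=|a(v)\rangle$, and let $X_{L,\psi}:(H\otimes H^*)\otimes V_\Gamma\to V_\Gamma\otimes(H\otimes H^*)$ be $X_{L,\psi}(\xi\otimes|w\rangle)=|L|^{-1/2}\sum_{a\in L}|a(w)\rangle\otimes |U_a\rangle\langle U_a|\xi\rangle$,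 where $|U_a\rangle\in H\otimes H^*$ is the vector corresponding to $U_a\in \mathrm{End}(H)$. Bending the input leg $H$ of $X_{L,\psi}$ to an output leg $H^*$ and the output leg $H^*$ to an input leg $H$, and multiplying by $1/n$, gives a dagger idempotent on $H^*\otimes V_\Gamma\otimes H$. Let $A$ be its image, $i:A\to H^*\otimes V_\Gamma\otimes H$ the inclusion, and $P:H\otimes A\to V_\Gamma\otimes H$ the map obtained from $\sqrt n\, i$ by bending $H^*$ down; write $P(h\otimes F)=\sum_v|v\rangle\otimes P_{F,v}h$. Then $\Gamma_{L,\psi}$ is the quantum graph on $A$ whose multiplication $F\cdot K$, unit $u$ and adjacency matrix $\Gamma_{L,\psi}$ are determined by the following equations, for all $F,K,M\in A$: $$\langle M,F\cdot K\rangle=\tfrac1n\sum_v\mathrm{Tr}(P_{M,v}^\dagger P_{K,v}P_{F,v}),\quad \langle M,u\rangle=\tfrac1n\sum_v\mathrm{Tr}(P_{M,v}^\dagger),\quad \langle M,\Gamma_{L,\psi}F\rangle=\tfrac1n\sum_{v,w}\Gamma_{v,w}\mathrm{Tr}(P_{M,v}^\dagger P_{F,w}).$$ \textbf{Theorem.}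 Let $\Gamma$ be a classical graph and let $(L,\psi)$ be a subgroup of central type of $\mathrm{Aut}(\Gamma)$. Then $(L,\psi)$ has a nice unitary error basis, and for every choice of a nice unitary error basis the quantum graph $\Gamma_{L,\psi}$ constructed from it is a classical graph if and only if for every vertex $v\in V_\Gamma$ the stabiliser subgroup $\mathrm{Stab}_L(v)=\{h\in L\mid h(v)=v\}$ is coisotropic, that is, $$\{a\in L\mid \rho_\psi(a,b)=1\ \text{for all } b\in \mathrm{Stab}_L(v) \text{ with } ab=ba\}\subseteq \mathrm{Stab}_L(v).$$ -/

import Mathlib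

open scoped TensorProduct

noncomputable section

/-! ### 2-cocycles, twisted group algebras, groups of central type -/

/-- A 2-cocycle `L × L → U(1)` (trivial action) on a group `L`. -/
structure TwoCocycle (L : Type*) [Group L] where
  toFun : L → L → Circle
  cocycle : ∀ a b c, toFun a b * toFun (a * b) c = toFun a (b * c) * toFun b c

namespace TwoCocycle

variable {L : Type*} [Group L]

instance : CoeFun (TwoCocycle L) (fun _ => L → L → Circle) := ⟨TwoCocycle.toFun⟩

theorem apply_one_left (ψ : TwoCocycle L) (a : L) : ψ 1 a = ψ 1 1 := by
  have h := ψ.cocycle 1 1 a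
  simp only [one_mul] at h
  exact (mul_right_cancel h).symm

theorem apply_one_right (ψ : TwoCocycle L) (a : L) : ψ a 1 = ψ 1 1 := by
  have h := ψ.cocycle a 1 1
  simp only [mul_one] at h
  exact mul_left_cancel h

/-- The twisted group algebra `ℂL^ψ` of a finite group: functions `f : L → ℂ`, thought of as formal
sums `∑ a, f a • a`, with the product determined by `a ⋆ b = ψ(a,b) ab`. -/
def Algebra (_ψ : TwoCocycle L) : Type _ := L → ℂ

namespace Algebra

variable (ψ : TwoCocycle L)

instance : AddCommGroup ψ.Algebra := inferInstanceAs (AddCommGroup (L → ℂ))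

instance : Module ℂ ψ.Algebra := inferInstanceAs (Module ℂ (L → ℂ))

variable {ψ}

@[ext] theorem ext {f g : ψ.Algebra} (h : ∀ a, f a = g a) : f = g := funext h

theorem add_apply (f g : ψ.Algebra) (c : L) : (f + g) c = f c + g c := rfl

theorem zero_apply (c : L) : (0 : ψ.Algebra) c = 0 := rfl

open Classical in
instance : One ψ.Algebra := ⟨fun a => if a = 1 then ((ψ 1 1 : ℂ))⁻¹ else 0⟩

open Classical in
theorem one_apply (a : L) : (1 : ψ.Algebra) a = if a = 1 then ((ψ 1 1 : ℂ))⁻¹ else 0 := rfl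

variable [Fintype L]

instance : Mul ψ.Algebra :=
  ⟨fun f g c => ∑ a, (ψ a (a⁻¹ * c) : ℂ) * (f a * g (a⁻¹ * c))⟩

theorem mul_apply (f g : ψ.Algebra) (c : L) :
    (f * g) c = ∑ a, (ψ a (a⁻¹ * c) : ℂ) * (f a * g (a⁻¹ * c)) := rfl

instance : Ring ψ.Algebra :=
  { (inferInstance : AddCommGroup ψ.Algebra),
    (inferInstance : Mul ψ.Algebra),
    (inferInstance : One ψ.Algebra) with
    left_distrib := fun f g h => by
      ext c
      simp only [mul_apply, add_apply, mul_add, Finset.sum_add_distrib]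
    right_distrib := fun f g h => by
      ext c
      simp only [mul_apply, add_apply, mul_add, add_mul, Finset.sum_add_distrib]
    zero_mul := fun f => by
      ext c
      simp [mul_apply, zero_apply]
    mul_zero := fun f => by
      ext c
      simp [mul_apply, zero_apply]
    mul_assoc := fun f g h => by
      ext d
      simp only [mul_apply, Finset.mul_sum, Finset.sum_mul]
      rw [Finset.sum_comm]
      refine Finset.sum_congr rfl fun a _ => ?_
      refine (Fintype.sum_equiv (Equiv.mulLeft a) _ _ fun c => ?_).symm
      have h1 := congrArg (fun z : Circle => (z : ℂ)) (ψ.cocycle a c (c⁻¹ * (a⁻¹ * d)))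
      simp only [Circle.coe_mul, mul_inv_cancel_left] at h1
      simp only [Equiv.coe_mulLeft, inv_mul_cancel_left, mul_inv_rev, mul_assoc]
      linear_combination (-(f a * g c * h (c⁻¹ * (a⁻¹ * d)))) * h1
    one_mul := fun f => by
      ext c
      rw [mul_apply, Finset.sum_eq_single 1]
      · simp [one_apply, ψ.apply_one_left c]
      · intro b _ hb
        simp [one_apply, hb]
      · simp
    mul_one := fun f => by
      ext c
      rw [mul_apply, Finset.sum_eq_single c]
      · simp only [inv_mul_cancel, one_apply, ψ.apply_one_right c, if_true]
        field_simp
      · intro b _ hb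
        have : b⁻¹ * c ≠ 1 := fun h => hb (inv_mul_eq_one.mp h)
        simp [one_apply, this]
      · simp }

end Algebra

/-- A 2-cocycle `ψ` on a finite group `L` is non-degenerate, i.e. `(L, ψ)` is a group of central
type, if the twisted group algebra is simple. -/
def IsNondegenerate [Fintype L] (ψ : TwoCocycle L) : Prop := IsSimpleRing ψ.Algebra

/-- `ρ_ψ(a,b) = ψ(a,b) · conj ψ(aba⁻¹,a)`; conjugation is inversion in `U(1)`. -/
def rho (ψ : TwoCocycle L) (a b : L) : Circle := ψ a b * (ψ (a * b * a⁻¹) a)⁻¹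

/-- The orthogonal complement `S^⊥ = {g | ρ_ψ(g,a) = 1 for all a ∈ Z_g ∩ S}`. -/
def orthogonalComplement (ψ : TwoCocycle L) (S : Set L) : Set L :=
  {g | ∀ a ∈ S, a * g = g * a → ψ.rho g a = 1}

/-- A subset is coisotropic if it contains its orthogonal complement. -/
def IsCoisotropic (ψ : TwoCocycle L) (S : Set L) : Prop := ψ.orthogonalComplement S ⊆ S

end TwoCocycle

/-- A nice unitary error basis for `(L, ψ)` on the Hilbert space `ℂⁿ`. -/
structure NiceUEB {L : Type*} [Group L] [Fintype L] (ψ : TwoCocycle L) (n : ℕ) where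
  U : L → Matrix (Fin n) (Fin n) ℂ
  unitary : ∀ a, U a ∈ Matrix.unitaryGroup (Fin n) ℂ
  card_eq : Fintype.card L = n ^ 2
  trace_self : ∀ a, ((U a).conjTranspose * U a).trace = n
  trace_ne : ∀ a b, a ≠ b → ((U a).conjTranspose * U b).trace = 0
  mul_eq : ∀ a b, U a * U b = (ψ a b : ℂ) • U (a * b)

/-! ### Quantum graphs -/

/-- A special symmetric dagger Frobenius algebra in finite-dimensional Hilbert spaces, given by
its multiplication `m : A ⊗ A → A` and its unit `u`. The comultiplication is `m†`, the counit is
`⟨u, -⟩`. -/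
structure IsSpecialSymmetricDaggerFrobenius {A : Type*} [NormedAddCommGroup A]
    [InnerProductSpace ℂ A] [FiniteDimensional ℂ A] (m : A ⊗[ℂ] A →ₗ[ℂ] A) (u : A) : Prop where
  assoc : ∀ a b c : A, m (m (a ⊗ₜ b) ⊗ₜ c) = m (a ⊗ₜ m (b ⊗ₜ c))
  unit_mul : ∀ a : A, m (u ⊗ₜ a) = a
  mul_unit : ∀ a : A, m (a ⊗ₜ u) = a
  frobenius_left : m.lTensor A ∘ₗ (TensorProduct.assoc ℂ A A A).toLinearMap ∘ₗ
    m.adjoint.rTensor A = m.adjoint ∘ₗ m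
  frobenius_right : m.rTensor A ∘ₗ (TensorProduct.assoc ℂ A A A).symm.toLinearMap ∘ₗ
    m.adjoint.lTensor A = m.adjoint ∘ₗ m
  special : m ∘ₗ m.adjoint = LinearMap.id
  symmetric : ∀ a b : A, inner ℂ u (m (a ⊗ₜ b)) = inner ℂ u (m (b ⊗ₜ a))

/-- The rotation `(1 ⊗ cap) (1 ⊗ T ⊗ 1) (cup ⊗ 1)` of an endomorphism `T` of a Frobenius algebra,
with `cup = m†(u)` and `cap = ⟨u, m(-)⟩`. -/
def frobeniusRotation {A : Type*} [NormedAddCommGroup A] [InnerProductSpace ℂ A]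
    [FiniteDimensional ℂ A] (m : A ⊗[ℂ] A →ₗ[ℂ] A) (u : A) (T : A →ₗ[ℂ] A) : A →ₗ[ℂ] A :=
  (TensorProduct.rid ℂ A).toLinearMap ∘ₗ (innerₛₗ ℂ u ∘ₗ m).lTensor A ∘ₗ
    (TensorProduct.assoc ℂ A A A).toLinearMap ∘ₗ (T.lTensor A).rTensor A ∘ₗ
      TensorProduct.mk ℂ (A ⊗[ℂ] A) A (m.adjoint u)

/-- A quantum graph: a special symmetric dagger Frobenius algebra (the quantum set of vertices)
with a self-adjoint quantum adjacency matrix satisfying the three axioms which for a commutative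
algebra say that the adjacency matrix has entries in `{0, 1}`, is symmetric, and is reflexive. -/
structure QuantumGraph where
  Vertices : Type*
  [normedAddCommGroup : NormedAddCommGroup Vertices]
  [innerProductSpace : InnerProductSpace ℂ Vertices]
  [finiteDimensional : FiniteDimensional ℂ Vertices]
  mul : Vertices ⊗[ℂ] Vertices →ₗ[ℂ] Vertices
  unit : Vertices
  frobenius : IsSpecialSymmetricDaggerFrobenius mul unit
  adj : Vertices →ₗ[ℂ] Vertices
  adj_selfAdjoint : adj.adjoint = adj
  adj_idempotent : mul ∘ₗ TensorProduct.map adj adj ∘ₗ mul.adjoint = adj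
  adj_symmetric : frobeniusRotation mul unit adj = adj
  adj_reflexive : mul ∘ₗ TensorProduct.map adj LinearMap.id ∘ₗ mul.adjoint = LinearMap.id

attribute [instance] QuantumGraph.normedAddCommGroup QuantumGraph.innerProductSpace
  QuantumGraph.finiteDimensional

/-- A quantum graph is classical if its algebra of vertices is commutative. -/
def QuantumGraph.IsClassical (Q : QuantumGraph) : Prop :=
  ∀ a b : Q.Vertices, Q.mul (a ⊗ₜ b) = Q.mul (b ⊗ₜ a)

section Builder

variable {A : Type*} [NormedAddCommGroup A] [InnerProductSpace ℂ A] [FiniteDimensional ℂ A]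
  {m : A ⊗[ℂ] A →ₗ[ℂ] A} {u : A} {s : A → A} {ι : Type*} [Fintype ι]

theorem adjoint_mul_eq_left (e : OrthonormalBasis ι ℂ A)
    (h : ∀ a b c, inner ℂ (m (a ⊗ₜ b)) c = inner ℂ b (m (s a ⊗ₜ c))) (x : A) :
    m.adjoint x = ∑ i, e i ⊗ₜ[ℂ] m (s (e i) ⊗ₜ x) := by
  rw [TensorProduct.ext_iff_inner_left (𝕜 := ℂ)]
  intro a b
  rw [LinearMap.adjoint_inner_right, inner_sum]
  simp only [TensorProduct.inner_tmul, ← h]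
  conv_lhs => rw [← e.sum_repr a, TensorProduct.sum_tmul, map_sum, sum_inner]
  refine Finset.sum_congr rfl fun i _ => ?_
  rw [← TensorProduct.smul_tmul', map_smul, inner_smul_left, e.repr_apply_apply, inner_conj_symm]

theorem adjoint_mul_eq_right (e : OrthonormalBasis ι ℂ A)
    (h : ∀ a b c, inner ℂ (m (a ⊗ₜ b)) c = inner ℂ a (m (c ⊗ₜ s b))) (x : A) :
    m.adjoint x = ∑ i, m (x ⊗ₜ s (e i)) ⊗ₜ[ℂ] e i := by
  rw [TensorProduct.ext_iff_inner_left (𝕜 := ℂ)]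
  intro a b
  rw [LinearMap.adjoint_inner_right, inner_sum]
  simp only [TensorProduct.inner_tmul, ← h]
  conv_lhs => rw [← e.sum_repr b, TensorProduct.tmul_sum, map_sum, sum_inner]
  refine Finset.sum_congr rfl fun i _ => ?_
  rw [TensorProduct.tmul_smul, map_smul, inner_smul_left, e.repr_apply_apply, inner_conj_symm,
    mul_comm]

theorem isSpecialSymmetricDaggerFrobenius_of (e : OrthonormalBasis ι ℂ A)
    (assoc : ∀ a b c : A, m (m (a ⊗ₜ b) ⊗ₜ c) = m (a ⊗ₜ m (b ⊗ₜ c)))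
    (unit_mul : ∀ a : A, m (u ⊗ₜ a) = a) (mul_unit : ∀ a : A, m (a ⊗ₜ u) = a)
    (hl : ∀ a b c, inner ℂ (m (a ⊗ₜ b)) c = inner ℂ b (m (s a ⊗ₜ c)))
    (hr : ∀ a b c, inner ℂ (m (a ⊗ₜ b)) c = inner ℂ a (m (c ⊗ₜ s b)))
    (hs : ∀ x, ∑ i, m (m (x ⊗ₜ s (e i)) ⊗ₜ e i) = x) :
    IsSpecialSymmetricDaggerFrobenius m u where
  assoc := assoc
  unit_mul := unit_mul
  mul_unit := mul_unit
  frobenius_left := by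
    ext a b
    simp only [TensorProduct.AlgebraTensorModule.curry_apply, TensorProduct.curry_apply,
      LinearMap.coe_restrictScalars, LinearMap.comp_apply, LinearMap.rTensor_tmul,
      adjoint_mul_eq_left e hl, TensorProduct.sum_tmul, map_sum, LinearEquiv.coe_coe,
      TensorProduct.assoc_tmul, LinearMap.lTensor_tmul, assoc]
  frobenius_right := by
    ext a b
    simp only [TensorProduct.AlgebraTensorModule.curry_apply, TensorProduct.curry_apply,
      LinearMap.coe_restrictScalars, LinearMap.comp_apply, LinearMap.lTensor_tmul,
      adjoint_mul_eq_right e hr, TensorProduct.tmul_sum, map_sum, LinearEquiv.coe_coe,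
      TensorProduct.assoc_symm_tmul, LinearMap.rTensor_tmul, assoc]
  special := by
    ext x
    simp only [LinearMap.comp_apply, adjoint_mul_eq_right e hr, map_sum, hs, LinearMap.id_apply]
  symmetric := by
    intro a b
    rw [← inner_conj_symm, hl, inner_conj_symm, ← inner_conj_symm u, hr b a, inner_conj_symm,
      unit_mul, mul_unit]

theorem frobeniusRotation_of (e : OrthonormalBasis ι ℂ A) {T : A →ₗ[ℂ] A}
    (mul_unit : ∀ a : A, m (a ⊗ₜ u) = a)
    (hl : ∀ a b c, inner ℂ (m (a ⊗ₜ b)) c = inner ℂ b (m (s a ⊗ₜ c)))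
    (ss : ∀ a, s (s a) = a) (hT : ∀ a, s (T a) = T (s a)) (hadj : T.adjoint = T) :
    frobeniusRotation m u T = T := by
  refine LinearMap.ext fun a => ?_
  simp only [frobeniusRotation, LinearMap.comp_apply, TensorProduct.mk_apply, LinearMap.sum_apply,
    adjoint_mul_eq_left e hl, mul_unit, map_sum, LinearMap.rTensor_tmul,
    LinearMap.lTensor_tmul, LinearEquiv.coe_coe, TensorProduct.assoc_tmul,
    TensorProduct.rid_tmul, innerₛₗ_apply_apply]
  conv_rhs => rw [← e.sum_repr (T a)]
  refine Finset.sum_congr rfl fun i _ => ?_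
  congr 1
  rw [← inner_conj_symm, hl, inner_conj_symm, mul_unit, hT, ss, e.repr_apply_apply]
  conv_lhs => rw [← hadj]
  rw [LinearMap.adjoint_inner_left]

theorem adjoint_eq_self_of {T : A →ₗ[ℂ] A} (h : ∀ a b, inner ℂ (T a) b = inner ℂ a (T b)) :
    T.adjoint = T :=
  ((LinearMap.eq_adjoint_iff T T).mpr h).symm

end Builder

/-! ### The quantum graph `Γ_{L,ψ}` -/

section Construction

set_option linter.unusedSectionVars false

open Matrix

variable {V : Type*} [Fintype V] [DecidableEq V] {G : SimpleGraph V} {L : Subgroup (G ≃g G)}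
  [Fintype L] {ψ : TwoCocycle L} {n : ℕ}

/-- The adjacency matrix of a classical graph; every vertex is adjacent to itself. -/
def reflexiveAdjacency (G : SimpleGraph V) [DecidableRel G.Adj] : Matrix V V ℂ :=
  fun v w => if v = w ∨ G.Adj v w then 1 else 0

namespace NiceUEB

/-- The simple dagger Frobenius monoid `X_{L,ψ} : (H ⊗ H*) ⊗ V_Γ → V_Γ ⊗ (H ⊗ H*)`, where `H = ℂⁿ`:
`X_{L,ψ} = |L|^{-1/2} ∑ a, a ⊗ |U_a⟩⟨U_a|` up to the ordering of the tensor factors, with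
`a |w⟩ = |a w⟩` and `|U_a⟩ = ∑ i j, (U_a)_{ij} |i⟩ ⊗ ⟨j|`. -/
def frobeniusMonoid (B : NiceUEB ψ n) :
    Matrix (V × (Fin n × Fin n)) ((Fin n × Fin n) × V) ℂ :=
  fun x y => ((Real.sqrt (Fintype.card L) : ℝ) : ℂ)⁻¹ *
    ∑ a : L, if (a : G ≃g G) y.2 = x.1 then B.U a x.2.1 x.2.2 * star (B.U a y.1.1 y.1.2) else 0

/-- The dagger idempotent on `H* ⊗ V_Γ ⊗ H` obtained from `X_{L,ψ}` by bending the input leg `H` up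
to an output leg `H*`, bending the output leg `H*` down to an input leg `H`, and dividing by `n`. -/
def idempotent (B : NiceUEB ψ n) : Matrix (Fin n × V × Fin n) (Fin n × V × Fin n) ℂ :=
  fun x y => (n : ℂ)⁻¹ * B.frobeniusMonoid (x.2.1, (x.2.2, y.2.2)) ((x.1, y.1), y.2.1)

/-- The Hilbert space `A` splitting the idempotent; the isometry `i : A → H* ⊗ V_Γ ⊗ H` is the
inclusion, and `i†` is the orthogonal projection. -/
def Space (B : NiceUEB ψ n) : Submodule ℂ (EuclideanSpace ℂ (Fin n × V × Fin n)) :=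
  LinearMap.range (Matrix.toEuclideanLin B.idempotent)

/-- The linear map `P : H ⊗ A → V_Γ ⊗ H` obtained from `√n • i` by bending the leg `H*` down. It is
recorded by its components `P F v : H → H`, so that `P (h ⊗ F) = ∑ v, |v⟩ ⊗ P F v h`. -/
def P (B : NiceUEB ψ n) (F : B.Space) (v : V) : Matrix (Fin n) (Fin n) ℂ :=
  ((Real.sqrt n : ℝ) : ℂ) • Matrix.of fun q p => (F : EuclideanSpace ℂ (Fin n × V × Fin n)) (p, v, q)

/-- Closing up the Hilbert space wire to a loop, which passes back over the output wire through the
partial transpose of `P†`, and dividing by `n`. For `T : H → V_Γ ⊗ H` with components `T v`,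
this gives the element of `A` with `⟨K, loop T⟩ = n⁻¹ ∑ v, tr ((P K v)† (T v))` for all `K`. -/
def loop (B : NiceUEB ψ n) (T : V → Matrix (Fin n) (Fin n) ℂ) : B.Space :=
  B.Space.orthogonalProjectionOnto (WithLp.toLp 2 fun x : Fin n × V × Fin n =>
    (n : ℂ)⁻¹ * ((Real.sqrt n : ℝ) : ℂ) * T x.2.1 x.2.2 x.1)

variable (B : NiceUEB ψ n)

theorem P_add (F K : B.Space) (v : V) : B.P (F + K) v = B.P F v + B.P K v := by
  ext q p; simp [P, mul_add]

theorem P_smul (c : ℂ) (F : B.Space) (v : V) : B.P (c • F) v = c • B.P F v := by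
  ext q p; simp [P]; ring

theorem loop_add (T S : V → Matrix (Fin n) (Fin n) ℂ) : B.loop (T + S) = B.loop T + B.loop S := by
  rw [loop, loop, loop, ← map_add]; congr 1; ext x; simp [mul_add]

theorem loop_smul (c : ℂ) (T : V → Matrix (Fin n) (Fin n) ℂ) :
    B.loop (c • T) = c • B.loop T := by
  rw [loop, loop, ← map_smul]; congr 1; ext x; simp; ring

/-- The product of `F` and `K` : the Hilbert space wire passes first through `F`, then through `K`,
the two `V_Γ`-wires are multiplied, and the wire is closed up. -/
def mul : B.Space ⊗[ℂ] B.Space →ₗ[ℂ] B.Space :=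
  TensorProduct.lift (LinearMap.mk₂ ℂ (fun F K => B.loop fun v => B.P K v * B.P F v)
    (fun F F' K => by rw [← loop_add]; congr 1; ext1 v; simp [P_add, Matrix.mul_add])
    (fun c F K => by rw [← loop_smul]; congr 1; ext1 v; simp [P_smul])
    (fun F K K' => by rw [← loop_add]; congr 1; ext1 v; simp [P_add, Matrix.add_mul])
    (fun c F K => by rw [← loop_smul]; congr 1; ext1 v; simp [P_smul]))

/-- The unit: the unit `∑ v, |v⟩` of `V_Γ`, encircled by the Hilbert space wire. -/
def unit : B.Space := B.loop fun _ => 1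

/-- The quantum adjacency matrix: the adjacency matrix of `Γ`, encircled by the Hilbert space
wire. -/
def adj [DecidableRel G.Adj] : B.Space →ₗ[ℂ] B.Space where
  toFun F := B.loop fun v => ∑ w, reflexiveAdjacency G v w • B.P F w
  map_add' F K := by
    rw [← loop_add]; congr 1; ext1 v; simp [P_add, Finset.sum_add_distrib]
  map_smul' c F := by
    rw [RingHom.id_apply, ← loop_smul]; congr 1; ext1 v
    simp only [P_smul, Pi.smul_apply, Finset.smul_sum]
    exact Finset.sum_congr rfl fun w _ => smul_comm _ _ _

/-! The remaining lemmas check that these data form a quantum graph. -/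

/-- The components of a vector of `H* ⊗ V_Γ ⊗ H`, as operators on `H`. -/
def comp (F : EuclideanSpace ℂ (Fin n × V × Fin n)) (v : V) : Matrix (Fin n) (Fin n) ℂ :=
  Matrix.of fun q p => F (p, v, q)

theorem comp_ext {F K : EuclideanSpace ℂ (Fin n × V × Fin n)} (h : ∀ v, comp F v = comp K v) :
    F = K := by
  ext ⟨p, v, q⟩
  exact congrFun (congrFun (h v) q) p

theorem P_eq (F : B.Space) (v : V) :
    B.P F v = ((Real.sqrt n : ℝ) : ℂ) • comp (F : EuclideanSpace ℂ _) v := rfl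

theorem inner_eq (F K : EuclideanSpace ℂ (Fin n × V × Fin n)) :
    inner ℂ F K = ∑ v, ((comp F v)ᴴ * comp K v).trace := by
  simp only [PiLp.inner_apply, Fintype.sum_prod_type, Matrix.trace, Matrix.diag, Matrix.mul_apply,
    Matrix.conjTranspose_apply, comp, Matrix.of_apply, RCLike.inner_apply]
  rw [Finset.sum_comm]
  refine Finset.sum_congr rfl fun v _ => Finset.sum_congr rfl fun p _ =>
    Finset.sum_congr rfl fun q _ => ?_
  rw [mul_comm]; rfl

theorem n_ne_zero (B : NiceUEB ψ n) : (n : ℂ) ≠ 0 := by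
  have h := B.card_eq
  have h1 : 0 < Fintype.card L := Fintype.card_pos
  intro h0
  have : n = 0 := by exact_mod_cast h0
  subst this
  simp at h

theorem sqrt_mul_sqrt : ((Real.sqrt n : ℝ) : ℂ) * ((Real.sqrt n : ℝ) : ℂ) = n := by
  rw [← Complex.ofReal_mul, Real.mul_self_sqrt (Nat.cast_nonneg n)]; simp

theorem sqrt_card (B : NiceUEB ψ n) : ((Real.sqrt (Fintype.card L) : ℝ) : ℂ) = n := by
  rw [B.card_eq]; push_cast; rw [Real.sqrt_sq (Nat.cast_nonneg n)]; simp

theorem U_mul_star (a : L) : B.U a * (B.U a)ᴴ = 1 := Matrix.mem_unitaryGroup_iff.mp (B.unitary a)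

theorem star_mul_U (a : L) : (B.U a)ᴴ * B.U a = 1 := Matrix.mem_unitaryGroup_iff'.mp (B.unitary a)

theorem conj_mul_conj (a b : L) (M : Matrix (Fin n) (Fin n) ℂ) :
    B.U a * (B.U b * M * (B.U b)ᴴ) * (B.U a)ᴴ = B.U (a * b) * M * (B.U (a * b))ᴴ := by
  have h : B.U a * (B.U b * M * (B.U b)ᴴ) * (B.U a)ᴴ =
      (B.U a * B.U b) * M * (B.U a * B.U b)ᴴ := by
    rw [Matrix.conjTranspose_mul]; simp only [Matrix.mul_assoc]
  rw [h, B.mul_eq, Matrix.conjTranspose_smul]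
  simp only [Matrix.smul_mul, Matrix.mul_smul, smul_smul]
  have : star ((ψ a b : Circle) : ℂ) * (ψ a b : ℂ) = 1 := by
    have := Circle.normSq_coe (ψ a b)
    rw [Complex.star_def, ← Complex.normSq_eq_conj_mul_self, this]; simp
  rw [this, one_smul]

theorem U_one : B.U 1 = (ψ 1 1 : ℂ) • 1 := by
  have h := B.mul_eq 1 1
  rw [mul_one] at h
  calc B.U 1 = (B.U 1 * B.U 1) * (B.U 1)ᴴ := by rw [Matrix.mul_assoc, U_mul_star, Matrix.mul_one]
    _ = _ := by rw [h, Matrix.smul_mul, U_mul_star]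

theorem comp_idempotent (F : EuclideanSpace ℂ (Fin n × V × Fin n)) (v : V) :
    comp (Matrix.toEuclideanLin B.idempotent F) v =
      ((n : ℂ)⁻¹ * (n : ℂ)⁻¹) •
        ∑ a : L, B.U a * comp F (((a⁻¹ : L) : G ≃g G) v) * (B.U a)ᴴ := by
  ext q' p'
  simp only [comp, Matrix.of_apply, Matrix.toLpLin_apply, Matrix.mulVec, dotProduct, idempotent,
    frobeniusMonoid, B.sqrt_card, Fintype.sum_prod_type, Matrix.smul_apply, Matrix.sum_apply,
    Matrix.mul_apply, Matrix.conjTranspose_apply, smul_eq_mul]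
  have key : ∀ (a : L) (w : V), (a : G ≃g G) w = v ↔ w = ((a⁻¹ : L) : G ≃g G) v := by
    intro a w
    constructor
    · rintro rfl
      simp
    · rintro rfl
      simp
  have h1 : ∀ (p : Fin n) (w : V) (q : Fin n),
      (n : ℂ)⁻¹ * ((n : ℂ)⁻¹ * ∑ a : L, if (a : G ≃g G) w = v then
        B.U a q' q * star (B.U a p' p) else 0) * F (p, w, q) =
      ((n : ℂ)⁻¹ * (n : ℂ)⁻¹) * ∑ a : L, if w = ((a⁻¹ : L) : G ≃g G) v then
        B.U a q' q * F (p, w, q) * star (B.U a p' p) else 0 := by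
    intro p w q
    simp only [key, Finset.mul_sum, Finset.sum_mul]
    refine Finset.sum_congr rfl fun a _ => ?_
    split_ifs <;> ring
  simp only [h1, ← Finset.mul_sum]
  congr 1
  have h2 : ∀ p : Fin n, (∑ w : V, ∑ q : Fin n, ∑ a : L, if w = ((a⁻¹ : L) : G ≃g G) v then
        B.U a q' q * F (p, w, q) * star (B.U a p' p) else 0) =
      ∑ a : L, (∑ q, B.U a q' q * F (p, ((a⁻¹ : L) : G ≃g G) v, q)) * star (B.U a p' p) := by
    intro p
    calc _ = ∑ w : V, ∑ a : L, ∑ q : Fin n, if w = ((a⁻¹ : L) : G ≃g G) v then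
          B.U a q' q * F (p, w, q) * star (B.U a p' p) else 0 :=
        Finset.sum_congr rfl fun w _ => Finset.sum_comm
      _ = _ := by
        rw [Finset.sum_comm]
        refine Finset.sum_congr rfl fun a _ => ?_
        rw [Finset.sum_comm, Finset.sum_mul]
        refine Finset.sum_congr rfl fun q _ => ?_
        simp
  simp only [h2]
  rw [Finset.sum_comm]

theorem idempotent_covariant (F : EuclideanSpace ℂ (Fin n × V × Fin n)) (b : L) (v : V) :
    comp (Matrix.toEuclideanLin B.idempotent F) ((b : G ≃g G) v) =
      B.U b * comp (Matrix.toEuclideanLin B.idempotent F) v * (B.U b)ᴴ := by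
  simp only [comp_idempotent, Matrix.mul_smul, Matrix.smul_mul, Matrix.mul_sum, Matrix.sum_mul,
    conj_mul_conj]
  congr 1
  refine (Fintype.sum_equiv (Equiv.mulLeft b) _ _ fun c => ?_).symm
  simp [RelIso.mul_apply]

theorem idempotent_of_covariant {F : EuclideanSpace ℂ (Fin n × V × Fin n)}
    (h : ∀ (a : L) v, comp F ((a : G ≃g G) v) = B.U a * comp F v * (B.U a)ᴴ) :
    Matrix.toEuclideanLin B.idempotent F = F := by
  refine comp_ext fun v => ?_
  rw [comp_idempotent]
  have : ∀ a : L, B.U a * comp F (((a⁻¹ : L) : G ≃g G) v) * (B.U a)ᴴ = comp F v := by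
    intro a
    rw [← h]; simp
  simp only [this, Finset.sum_const, Finset.card_univ, B.card_eq]
  rw [← Nat.cast_smul_eq_nsmul ℂ, smul_smul]
  have hn := B.n_ne_zero
  push_cast
  rw [show (n : ℂ)⁻¹ * (n : ℂ)⁻¹ * (n : ℂ) ^ 2 = 1 by field_simp, one_smul]

theorem mem_space_iff {F : EuclideanSpace ℂ (Fin n × V × Fin n)} :
    F ∈ B.Space ↔ ∀ (a : L) v, comp F ((a : G ≃g G) v) = B.U a * comp F v * (B.U a)ᴴ := by
  constructor
  · rintro ⟨K, rfl⟩
    exact B.idempotent_covariant K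
  · intro h
    exact ⟨F, B.idempotent_of_covariant h⟩

theorem orthogonalProjection_eq (F : EuclideanSpace ℂ (Fin n × V × Fin n)) :
    (B.Space.orthogonalProjectionOnto F : EuclideanSpace ℂ (Fin n × V × Fin n)) =
      Matrix.toEuclideanLin B.idempotent F := by
  refine Submodule.eq_starProjection_of_mem_of_inner_eq_zero ⟨F, rfl⟩ ?_
  intro K hK
  rw [mem_space_iff] at hK
  rw [inner_sub_left, sub_eq_zero, inner_eq, inner_eq]
  simp only [comp_idempotent, Matrix.conjTranspose_smul, Matrix.conjTranspose_sum,
    Matrix.smul_mul, Matrix.sum_mul, Matrix.trace_smul, Matrix.trace_sum]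
  rw [← Finset.smul_sum, Finset.sum_comm]
  have : ∀ a : L, (∑ v, ((B.U a * comp F (((a⁻¹ : L) : G ≃g G) v) * (B.U a)ᴴ)ᴴ *
      comp K v).trace) = ∑ v, ((comp F v)ᴴ * comp K v).trace := by
    intro a
    refine Fintype.sum_equiv ((a⁻¹ : L) : G ≃g G).toEquiv _ _ fun v => ?_
    have h1 : comp K v = B.U a * comp K (((a⁻¹ : L) : G ≃g G) v) * (B.U a)ᴴ := by
      rw [← hK]; simp
    rw [h1]
    simp only [Matrix.conjTranspose_mul, Matrix.conjTranspose_conjTranspose]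
    have h2 : ∀ M N : Matrix (Fin n) (Fin n) ℂ,
        (B.U a * (M * (B.U a)ᴴ) * (B.U a * N * (B.U a)ᴴ)).trace = (M * N).trace := by
      intro M N
      have : B.U a * (M * (B.U a)ᴴ) * (B.U a * N * (B.U a)ᴴ) =
          B.U a * (M * (((B.U a)ᴴ * B.U a) * N)) * (B.U a)ᴴ := by
        simp only [Matrix.mul_assoc]
      rw [this, star_mul_U, Matrix.one_mul, Matrix.trace_mul_comm, ← Matrix.mul_assoc, star_mul_U,
        Matrix.one_mul]
    exact h2 _ _
  simp only [this, Finset.sum_const, Finset.card_univ, B.card_eq]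
  rw [← Nat.cast_smul_eq_nsmul ℂ, smul_smul]
  have hn := B.n_ne_zero
  push_cast
  rw [show star ((n : ℂ)⁻¹ * (n : ℂ)⁻¹) * (n : ℂ) ^ 2 = 1 by simp; field_simp, one_smul]

theorem comp_covariant (F : B.Space) (a : L) (v : V) :
    comp (F : EuclideanSpace ℂ (Fin n × V × Fin n)) ((a : G ≃g G) v) =
      B.U a * comp (F : EuclideanSpace ℂ (Fin n × V × Fin n)) v * (B.U a)ᴴ :=
  B.mem_space_iff.mp F.2 a v

theorem comp_loop {T : V → Matrix (Fin n) (Fin n) ℂ}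
    (h : ∀ (a : L) v, T ((a : G ≃g G) v) = B.U a * T v * (B.U a)ᴴ) (v : V) :
    comp (B.loop T : EuclideanSpace ℂ (Fin n × V × Fin n)) v =
      ((n : ℂ)⁻¹ * ((Real.sqrt n : ℝ) : ℂ)) • T v := by
  have h1 : ∀ v, comp (WithLp.toLp 2 fun x : Fin n × V × Fin n =>
      (n : ℂ)⁻¹ * ((Real.sqrt n : ℝ) : ℂ) * T x.2.1 x.2.2 x.1) v =
      ((n : ℂ)⁻¹ * ((Real.sqrt n : ℝ) : ℂ)) • T v := by
    intro v; ext q p; simp [comp]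
  rw [loop, orthogonalProjection_eq, idempotent_of_covariant, h1]
  intro a v
  rw [h1, h1, h, Matrix.mul_smul, Matrix.smul_mul]

theorem inner_loop (K : B.Space) (T : V → Matrix (Fin n) (Fin n) ℂ) :
    inner ℂ K (B.loop T) = (n : ℂ)⁻¹ * ∑ v, ((B.P K v)ᴴ * T v).trace := by
  have h1 : ∀ v, comp (WithLp.toLp 2 fun x : Fin n × V × Fin n =>
      (n : ℂ)⁻¹ * ((Real.sqrt n : ℝ) : ℂ) * T x.2.1 x.2.2 x.1) v =
      ((n : ℂ)⁻¹ * ((Real.sqrt n : ℝ) : ℂ)) • T v := by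
    intro v; ext q p; simp [comp]
  rw [loop, Submodule.inner_orthogonalProjectionOnto_eq_of_mem_left, inner_eq, Finset.mul_sum]
  refine Finset.sum_congr rfl fun v _ => ?_
  rw [h1, P_eq]
  simp [mul_assoc]

theorem comp_mul (F K : B.Space) (v : V) :
    comp (B.mul (F ⊗ₜ K) : EuclideanSpace ℂ (Fin n × V × Fin n)) v =
      ((Real.sqrt n : ℝ) : ℂ) • (comp (K : EuclideanSpace ℂ (Fin n × V × Fin n)) v *
        comp (F : EuclideanSpace ℂ (Fin n × V × Fin n)) v) := by
  have hn := B.n_ne_zero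
  rw [mul, TensorProduct.lift.tmul, LinearMap.mk₂_apply, comp_loop]
  · simp only [P_eq, Matrix.smul_mul, Matrix.mul_smul, smul_smul]
    congr 1
    have h := sqrt_mul_sqrt (n := n)
    field_simp
    linear_combination ((Real.sqrt n : ℝ) : ℂ) * h
  · intro a v
    simp only [P_eq, comp_covariant, Matrix.smul_mul, Matrix.mul_smul]
    congr 2
    have : ∀ M N : Matrix (Fin n) (Fin n) ℂ, B.U a * M * (B.U a)ᴴ * (B.U a * N * (B.U a)ᴴ) =
        B.U a * M * (((B.U a)ᴴ * B.U a) * (N * (B.U a)ᴴ)) := by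
      intro M N; simp only [Matrix.mul_assoc]
    rw [this, star_mul_U, Matrix.one_mul]
    simp only [Matrix.mul_assoc]

theorem comp_unit (v : V) :
    comp (B.unit : EuclideanSpace ℂ (Fin n × V × Fin n)) v =
      ((n : ℂ)⁻¹ * ((Real.sqrt n : ℝ) : ℂ)) • 1 := by
  rw [unit, comp_loop]
  intro a v
  rw [Matrix.mul_one, U_mul_star]

theorem reflexiveAdjacency_map [DecidableRel G.Adj] (a : G ≃g G) (v w : V) :
    reflexiveAdjacency G (a v) (a w) = reflexiveAdjacency G v w := by
  simp [reflexiveAdjacency, a.map_adj_iff]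

theorem comp_adj [DecidableRel G.Adj] (F : B.Space) (v : V) :
    comp (B.adj F : EuclideanSpace ℂ (Fin n × V × Fin n)) v =
      ∑ w, reflexiveAdjacency G v w • comp (F : EuclideanSpace ℂ (Fin n × V × Fin n)) w := by
  have hn := B.n_ne_zero
  change comp (B.loop fun v => ∑ w, reflexiveAdjacency G v w • B.P F w :
    EuclideanSpace ℂ (Fin n × V × Fin n)) v = _
  rw [comp_loop]
  · rw [Finset.smul_sum]
    refine Finset.sum_congr rfl fun w _ => ?_
    rw [P_eq, smul_comm, smul_smul ((n : ℂ)⁻¹ * _), mul_assoc, sqrt_mul_sqrt, inv_mul_cancel₀ hn,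
      one_smul]
  · intro a v
    rw [Matrix.mul_sum, Matrix.sum_mul]
    refine (Fintype.sum_equiv ((a : G ≃g G).toEquiv) _ _ fun w => ?_).symm
    change _ = reflexiveAdjacency G ((a : G ≃g G) v) ((a : G ≃g G) w) • B.P F ((a : G ≃g G) w)
    rw [reflexiveAdjacency_map, P_eq, P_eq, comp_covariant]
    simp only [Matrix.mul_smul, Matrix.smul_mul]

/-- The pointwise adjoint, an involution of the vertex algebra. -/
def adjointElement (F : B.Space) : B.Space :=
  ⟨WithLp.toLp 2 fun x => star ((F : EuclideanSpace ℂ (Fin n × V × Fin n)) (x.2.2, x.2.1, x.1)), by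
    rw [mem_space_iff]
    intro a v
    have h1 : ∀ v, comp (WithLp.toLp 2 fun x : Fin n × V × Fin n =>
        star ((F : EuclideanSpace ℂ (Fin n × V × Fin n)) (x.2.2, x.2.1, x.1))) v =
        (comp (F : EuclideanSpace ℂ (Fin n × V × Fin n)) v)ᴴ := fun v => rfl
    rw [h1, h1, comp_covariant]
    simp only [Matrix.conjTranspose_mul, Matrix.conjTranspose_conjTranspose, Matrix.mul_assoc]⟩

theorem comp_adjointElement (F : B.Space) (v : V) :
    comp (B.adjointElement F : EuclideanSpace ℂ (Fin n × V × Fin n)) v =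
      (comp (F : EuclideanSpace ℂ (Fin n × V × Fin n)) v)ᴴ := rfl

theorem space_ext {F K : B.Space} (h : ∀ v, comp (F : EuclideanSpace ℂ (Fin n × V × Fin n)) v =
    comp (K : EuclideanSpace ℂ (Fin n × V × Fin n)) v) : F = K :=
  Subtype.ext (comp_ext h)

theorem trace_U (a : L) (ha : a ≠ 1) : (B.U a).trace = 0 := by
  have h := B.trace_ne 1 a (Ne.symm ha)
  rw [U_one, Matrix.conjTranspose_smul, Matrix.smul_mul, Matrix.trace_smul,
    Matrix.conjTranspose_one, Matrix.one_mul, smul_eq_mul] at h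
  exact (mul_eq_zero.mp h).resolve_left (star_ne_zero.mpr (Circle.coe_ne_zero _))

theorem sum_basis {ι : Type*} [Fintype ι] (e : OrthonormalBasis ι ℂ B.Space)
    (x y : Fin n × V × Fin n) :
    ∑ i, (e i : EuclideanSpace ℂ (Fin n × V × Fin n)) x *
      star ((e i : EuclideanSpace ℂ (Fin n × V × Fin n)) y) = B.idempotent x y := by
  have h := e.sum_repr (B.Space.orthogonalProjectionOnto (EuclideanSpace.single y (1 : ℂ)))
  have h1 := congrArg (fun F : B.Space => (F : EuclideanSpace ℂ (Fin n × V × Fin n)) x) h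
  simp only [orthogonalProjection_eq] at h1
  have h2 : (Matrix.toEuclideanLin B.idempotent (EuclideanSpace.single y (1 : ℂ))) x =
      B.idempotent x y := by
    simp [Matrix.toLpLin_apply]
  rw [← h2, ← h1]
  simp only [Submodule.coe_sum, Submodule.coe_smul, WithLp.ofLp_sum, Finset.sum_apply,
    WithLp.ofLp_smul, Pi.smul_apply, smul_eq_mul]
  refine Finset.sum_congr rfl fun i _ => ?_
  rw [e.repr_apply_apply, Submodule.inner_orthogonalProjectionOnto_eq_of_mem_left,
    EuclideanSpace.inner_single_right]
  simp [mul_comm]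

theorem sum_comp_mul_comp {ι : Type*} [Fintype ι] (e : OrthonormalBasis ι ℂ B.Space) (v w : V) :
    ∑ i, comp (e i : EuclideanSpace ℂ (Fin n × V × Fin n)) v *
      (comp (e i : EuclideanSpace ℂ (Fin n × V × Fin n)) w)ᴴ =
      if v = w then (n : ℂ)⁻¹ • 1 else 0 := by
  have hn := B.n_ne_zero
  ext q q'
  simp only [Matrix.sum_apply, Matrix.mul_apply, Matrix.conjTranspose_apply, comp, Matrix.of_apply]
  rw [Finset.sum_comm]
  simp only [sum_basis, idempotent, frobeniusMonoid, B.sqrt_card, ← Finset.mul_sum]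
  rw [Finset.sum_comm]
  have h1 : ∀ a : L, (∑ p, if (a : G ≃g G) w = v then B.U a q q' * star (B.U a p p) else 0) =
      if (a : G ≃g G) w = v then B.U a q q' * star (B.U a).trace else 0 := by
    intro a
    split_ifs
    · rw [← Finset.mul_sum, Matrix.trace, star_sum]; rfl
    · simp
  simp only [h1]
  rw [Finset.sum_eq_single 1]
  · rw [U_one]
    have h2 : (ψ 1 1 : ℂ) * star (ψ 1 1 : ℂ) = 1 := by
      rw [Complex.star_def, Complex.mul_conj, Circle.normSq_coe]; simp
    by_cases hvw : v = w
    · subst hvw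
      simp only [OneMemClass.coe_one, RelIso.coe_one, id, if_true, Matrix.smul_apply,
        Matrix.trace_smul, Matrix.trace_one, Fintype.card_fin, smul_eq_mul, star_mul']
      simp only [star_natCast]
      field_simp
      linear_combination ((1 : Matrix (Fin n) (Fin n) ℂ) q q') * h2
    · simp [hvw, Ne.symm hvw]
  · intro a _ ha
    simp [trace_U B a ha]
  · simp

theorem mul_assoc' (F K M : B.Space) :
    B.mul (B.mul (F ⊗ₜ K) ⊗ₜ M) = B.mul (F ⊗ₜ B.mul (K ⊗ₜ M)) :=
  B.space_ext fun v => by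
    simp only [comp_mul, Matrix.smul_mul, Matrix.mul_smul, Matrix.mul_assoc]

theorem sqrt_mul_unit_scalar (B : NiceUEB ψ n) :
    ((Real.sqrt n : ℝ) : ℂ) * ((n : ℂ)⁻¹ * ((Real.sqrt n : ℝ) : ℂ)) = 1 := by
  have hn := B.n_ne_zero
  rw [mul_left_comm, sqrt_mul_sqrt, inv_mul_cancel₀ hn]

theorem unit_mul' (F : B.Space) : B.mul (B.unit ⊗ₜ F) = F :=
  B.space_ext fun v => by
    rw [comp_mul, comp_unit, Matrix.mul_smul, Matrix.mul_one, smul_smul, B.sqrt_mul_unit_scalar,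
      one_smul]

theorem mul_unit' (F : B.Space) : B.mul (F ⊗ₜ B.unit) = F :=
  B.space_ext fun v => by
    rw [comp_mul, comp_unit, Matrix.smul_mul, Matrix.one_mul, smul_smul, B.sqrt_mul_unit_scalar,
      one_smul]

theorem inner_mul_left' (F K M : B.Space) :
    inner ℂ (B.mul (F ⊗ₜ K)) M = inner ℂ K (B.mul (B.adjointElement F ⊗ₜ M)) := by
  rw [Submodule.coe_inner, Submodule.coe_inner, inner_eq, inner_eq]
  refine Finset.sum_congr rfl fun v _ => ?_
  simp only [comp_mul, comp_adjointElement, Matrix.conjTranspose_smul, Matrix.conjTranspose_mul,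
    Matrix.smul_mul, Matrix.mul_smul, Matrix.trace_smul, Complex.star_def, Complex.conj_ofReal]
  rw [Matrix.mul_assoc, Matrix.trace_mul_comm, Matrix.mul_assoc]

theorem inner_mul_right' (F K M : B.Space) :
    inner ℂ (B.mul (F ⊗ₜ K)) M = inner ℂ F (B.mul (M ⊗ₜ B.adjointElement K)) := by
  rw [Submodule.coe_inner, Submodule.coe_inner, inner_eq, inner_eq]
  refine Finset.sum_congr rfl fun v _ => ?_
  simp only [comp_mul, comp_adjointElement, Matrix.conjTranspose_smul, Matrix.conjTranspose_mul,
    Matrix.smul_mul, Matrix.mul_smul, Matrix.trace_smul, Complex.star_def, Complex.conj_ofReal]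
  rw [Matrix.mul_assoc]

theorem comp_sum {ι : Type*} [Fintype ι] (f : ι → B.Space) (v : V) :
    comp ((∑ i, f i : B.Space) : EuclideanSpace ℂ (Fin n × V × Fin n)) v =
      ∑ i, comp (f i : EuclideanSpace ℂ (Fin n × V × Fin n)) v := by
  ext q p
  simp [comp, Matrix.sum_apply]

theorem sum_mul_map {ι : Type*} [Fintype ι] (e : OrthonormalBasis ι ℂ B.Space)
    (S T : B.Space → B.Space) (s t : V → V → ℂ)
    (hS : ∀ F v, comp (S F : EuclideanSpace ℂ (Fin n × V × Fin n)) v =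
      ∑ w, s v w • comp (F : EuclideanSpace ℂ (Fin n × V × Fin n)) w)
    (hT : ∀ F v, comp (T F : EuclideanSpace ℂ (Fin n × V × Fin n)) v =
      ∑ w, t v w • comp (F : EuclideanSpace ℂ (Fin n × V × Fin n)) w) (F : B.Space) (v : V) :
    comp ((∑ i, B.mul (S (B.mul (F ⊗ₜ B.adjointElement (e i))) ⊗ₜ T (e i)) : B.Space) :
      EuclideanSpace ℂ (Fin n × V × Fin n)) v =
      ∑ w, (s v w * t v w) • comp (F : EuclideanSpace ℂ (Fin n × V × Fin n)) w := by
  have hn := B.n_ne_zero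
  rw [comp_sum]
  simp only [comp_mul, hS, hT, comp_adjointElement, Matrix.sum_mul, Matrix.mul_sum,
    Matrix.smul_mul, Matrix.mul_smul, Finset.smul_sum, smul_smul]
  rw [Finset.sum_comm]
  refine Finset.sum_congr rfl fun w _ => ?_
  rw [Finset.sum_comm]
  rw [Finset.sum_eq_single w]
  · simp only [← Matrix.mul_assoc, ← Finset.smul_sum]
    rw [← Matrix.sum_mul, sum_comp_mul_comp, if_pos rfl, Matrix.smul_mul, Matrix.one_mul, smul_smul]
    congr 1
    have h := sqrt_mul_sqrt (n := n)
    field_simp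
    linear_combination (s v w * t v w) * h
  · intro w' _ hw
    simp only [← Matrix.mul_assoc, ← Finset.smul_sum]
    rw [← Matrix.sum_mul, sum_comp_mul_comp]
    simp [hw]
  · simp

theorem isSpecialSymmetricDaggerFrobenius :
    IsSpecialSymmetricDaggerFrobenius B.mul B.unit := by
  refine isSpecialSymmetricDaggerFrobenius_of (s := B.adjointElement)
    (stdOrthonormalBasis ℂ B.Space) B.mul_assoc' B.unit_mul' B.mul_unit' B.inner_mul_left'
    B.inner_mul_right' fun F => B.space_ext fun v => ?_
  refine (B.sum_mul_map (stdOrthonormalBasis ℂ B.Space) id id (fun v w => if v = w then 1 else 0)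
    (fun v w => if v = w then 1 else 0) (by simp) (by simp) F v).trans ?_
  simp

theorem inner_adj [DecidableRel G.Adj] (F K : B.Space) :
    inner ℂ (B.adj F) K = inner ℂ F (B.adj K) := by
  rw [Submodule.coe_inner, Submodule.coe_inner, inner_eq, inner_eq]
  simp only [comp_adj, Matrix.conjTranspose_sum, Matrix.conjTranspose_smul, Matrix.sum_mul,
    Matrix.mul_sum, Matrix.smul_mul, Matrix.mul_smul, Matrix.trace_sum, Matrix.trace_smul]
  rw [Finset.sum_comm]
  refine Finset.sum_congr rfl fun v _ => Finset.sum_congr rfl fun w _ => ?_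
  congr 1
  simp only [reflexiveAdjacency, eq_comm, G.adj_comm w v]
  split_ifs <;> simp_all

/-- The quantum graph `Γ_{L,ψ}`, constructed from a nice unitary error basis for `(L, ψ)`. -/
def quantumGraph [DecidableRel G.Adj] : QuantumGraph where
  Vertices := B.Space
  mul := B.mul
  unit := B.unit
  frobenius := B.isSpecialSymmetricDaggerFrobenius
  adj := B.adj
  adj_selfAdjoint := (adjoint_eq_self_of B.inner_adj)
  adj_idempotent := by
    refine LinearMap.ext fun F => B.space_ext fun v => ?_
    simp only [LinearMap.comp_apply, map_sum, TensorProduct.map_tmul,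
      adjoint_mul_eq_right (stdOrthonormalBasis ℂ B.Space) B.inner_mul_right']
    rw [B.sum_mul_map (stdOrthonormalBasis ℂ B.Space) B.adj B.adj _ _ B.comp_adj B.comp_adj,
      comp_adj]
    refine Finset.sum_congr rfl fun w _ => ?_
    congr 1
    simp [reflexiveAdjacency]
  adj_symmetric := by
    refine frobeniusRotation_of (s := B.adjointElement) (stdOrthonormalBasis ℂ B.Space)
      B.mul_unit' B.inner_mul_left' (fun F => B.space_ext fun v => ?_)
      (fun F => B.space_ext fun v => ?_) (adjoint_eq_self_of B.inner_adj)
    · simp [comp_adjointElement]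
    · simp only [comp_adjointElement, comp_adj, Matrix.conjTranspose_sum,
        Matrix.conjTranspose_smul]
      refine Finset.sum_congr rfl fun w _ => ?_
      congr 1
      simp only [reflexiveAdjacency]
      split_ifs <;> simp
  adj_reflexive := by
    refine LinearMap.ext fun F => B.space_ext fun v => ?_
    simp only [LinearMap.comp_apply, map_sum, TensorProduct.map_tmul,
      adjoint_mul_eq_right (stdOrthonormalBasis ℂ B.Space) B.inner_mul_right']
    rw [B.sum_mul_map (stdOrthonormalBasis ℂ B.Space) B.adj LinearMap.id _
      (fun v w => if v = w then 1 else 0) B.comp_adj (by simp)]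
    simp [reflexiveAdjacency]

end NiceUEB

/-- The stabiliser `Stab_L(v) = {h ∈ L | h(v) = v}`, as a subset of `L`. -/
def vertexStabiliser (L : Subgroup (G ≃g G)) (v : V) : Set L := {h | (h : G ≃g G) v = v}

end Construction

end

/-! Existence of an error basis. Over `ℂ`, the simple algebra `ℂL^ψ` is a full matrix algebra
`M_n(ℂ)`, so `|L| = n²`, and the images of the group elements span `M_n(ℂ)` and multiply with
cocycle `ψ`. Averaging an inner product over `L` makes them unitary after a change of basis
(`exists_unitary_conjugate`). By Schur's lemma the twirl `∑ a, U_a Y U_a†` is the scalar `n tr Y`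
(`sum_conj_eq_trace_smul`). On matrix units this is a completeness relation, and for exactly `n²`
matrices completeness is the same as trace orthogonality
(`Matrix.trace_orthogonality_iff_completeness`).

Classicality. Elements of the vertex algebra are the functions `F : V → M_n(ℂ)` with `F(av) = U_a
F(v) U_a†`, and up to the factor `√n` their product is pointwise in the opposite order. Hence the
graph is classical exactly when, at every vertex `v`, the values `F(v)` commute with one another.
Write `S` for the stabiliser of `v`. Equivariance puts every value in the commutant of `{U_a | a ∈
S}`, while every twirl over `S` occurs as a value.

If the values commute, a double commutant argument puts each of them in the span of `{U_a | a ∈ S}`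
(`trace_eq_zero_of_commute_stabiliserTwirl`). For `g ∈ S^⊥` the twirl of `U_g` over `S` has nonzero
coefficient at `U_g` (`trace_stabiliserTwirl_ne_zero`), which forces `g ∈ S`.

Conversely, let `S` be coisotropic. Each `g ∉ S` commutes with some `a ∈ S` for which conjugation by
`U_a` multiplies `U_g` by a nontrivial phase. The same conjugation fixes `F(v)`, so `F(v)` has no
`U_g` component (`trace_comp_eq_zero`). Thus `F(v)` lies in the span of `{U_a | a ∈ S}`, with which
every value `K(v)` commutes. -/

open scoped Matrix

noncomputable section

/-! ### The twisted group algebra as a finite-dimensional complex algebra -/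

namespace TwoCocycle.Algebra

variable {L : Type*} [Group L] {ψ : TwoCocycle L}

theorem smul_apply (r : ℂ) (f : ψ.Algebra) (c : L) : (r • f) c = r * f c := rfl

variable (ψ) in
open Classical in
/-- The basis element of the twisted group algebra given by a group element. -/
def single (a : L) : ψ.Algebra := fun b => if b = a then 1 else 0

open Classical in
theorem single_apply (a b : L) : single ψ a b = if b = a then 1 else 0 := rfl

variable [Fintype L]

/-- Together with finite dimensionality, this lets the Wedderburn theorem over an algebraically
closed field identify a simple twisted group algebra with a matrix algebra. -/
instance instAlgebraComplex : _root_.Algebra ℂ ψ.Algebra :=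
  _root_.Algebra.ofModule
    (fun r f g => by
      ext c
      simp only [mul_apply, smul_apply, Finset.mul_sum]
      exact Finset.sum_congr rfl fun a _ => by ring)
    (fun r f g => by
      ext c
      simp only [mul_apply, smul_apply, Finset.mul_sum]
      exact Finset.sum_congr rfl fun a _ => by ring)

instance instFiniteComplex : Module.Finite ℂ ψ.Algebra :=
  inferInstanceAs (Module.Finite ℂ (L → ℂ))

theorem finrank_eq_card : Module.finrank ℂ ψ.Algebra = Fintype.card L :=
  Module.finrank_fintype_fun_eq_card ℂ

theorem single_mul_single (a b : L) :
    single ψ a * single ψ b = (ψ a b : ℂ) • single ψ (a * b) := by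
  ext c
  rw [mul_apply, Finset.sum_eq_single a, smul_apply]
  · by_cases h : c = a * b
    · subst h; simp [single_apply]
    · have h' : a⁻¹ * c ≠ b := fun h' => h (inv_mul_eq_iff_eq_mul.mp h')
      simp [single_apply, h, h']
  · intro d _ hd
    simp [single_apply, hd]
  · simp

/-- The cocycle is not assumed normalised, so a phase appears here. -/
theorem single_one : single ψ 1 = (ψ 1 1 : ℂ) • 1 := by
  ext c
  rw [smul_apply, one_apply, single_apply]
  split_ifs <;> simp

theorem sum_apply {ι : Type*} (s : Finset ι) (f : ι → ψ.Algebra) (c : L) :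
    (∑ i ∈ s, f i) c = ∑ i ∈ s, f i c :=
  Finset.sum_apply (M := fun _ : L => ℂ) c s f

theorem exists_eq_sum_single (f : ψ.Algebra) : ∃ c : L → ℂ, f = ∑ a, c a • single ψ a := by
  refine ⟨f, ?_⟩
  ext c
  simp only [sum_apply, smul_apply, single_apply]
  classical
  rw [Finset.sum_eq_single c] <;> simp +contextual [eq_comm]

end TwoCocycle.Algebra

/-! ### Matrix lemmas: commutants and orthogonality versus completeness -/

/-- Cocycle phases cancel in sesquilinear expressions by this identity, so averages over a
projective representation behave as for an ordinary one. -/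
theorem Circle.star_coe_mul_self (z : Circle) : star (z : ℂ) * (z : ℂ) = 1 := by
  rw [Complex.star_def, ← Complex.normSq_eq_conj_mul_self, Circle.normSq_coe]; simp

theorem Matrix.mul_single_mul_apply {n : ℕ} (A B : Matrix (Fin n) (Fin n) ℂ) (i j p q : Fin n) :
    (A * Matrix.single i j (1 : ℂ) * B : Matrix (Fin n) (Fin n) ℂ) p q = A p i * B j q := by
  rw [Matrix.mul_apply, Finset.sum_eq_single j]
  · simp
  · intro k _ hk
    rw [Matrix.mul_single_apply_of_ne _ _ _ _ _ hk, zero_mul]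
  · simp

/-- A matrix commuting with a spanning family of matrices is scalar. -/
theorem Matrix.exists_eq_smul_one_of_commute {ι : Type*} [Fintype ι] {n : ℕ}
    {U : ι → Matrix (Fin n) (Fin n) ℂ}
    (hspan : ∀ M, ∃ f : ι → ℂ, M = ∑ a, f a • U a) {Z : Matrix (Fin n) (Fin n) ℂ}
    (hZ : ∀ a, Commute (U a) Z) : ∃ c : ℂ, Z = c • 1 := by
  -- By spanning, commuting with the family implies commuting with every matrix unit.
  obtain ⟨c, hc⟩ := Matrix.mem_range_scalar_of_commute_single (M := Z) fun i j _ => by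
    obtain ⟨f, hf⟩ := hspan (Matrix.single i j 1)
    rw [hf]
    exact Commute.sum_left _ _ _ fun a _ => (hZ a).smul_left _
  exact ⟨c, by rw [← hc, Matrix.scalar_apply, Matrix.smul_one_eq_diagonal]⟩

/-- For `n ^ 2` matrices of size `n`, orthogonality with respect to the trace form amounts to the
completeness relation. -/
theorem Matrix.trace_orthogonality_iff_completeness {ι : Type*} [Fintype ι] [DecidableEq ι] {n : ℕ}
    (hn : (n : ℂ) ≠ 0) (hcard : Fintype.card ι = n ^ 2) (U : ι → Matrix (Fin n) (Fin n) ℂ) :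
    (∀ a b, ((U a)ᴴ * U b).trace = if a = b then (n : ℂ) else 0) ↔
      ∀ p q i j, ∑ a, U a p i * star (U a q j) = if p = q ∧ i = j then (n : ℂ) else 0 := by
  -- The rows of `W` are the flattened matrices `U a`. The two conditions say that `n⁻¹ Wᴴ` is a
  -- right, respectively a left, inverse of `W`.
  let W : Matrix ι (Fin n × Fin n) ℂ := Matrix.of fun a x => U a x.1 x.2
  have h1 : (∀ a b, ((U a)ᴴ * U b).trace = if a = b then (n : ℂ) else 0) ↔
      W * ((n : ℂ)⁻¹ • Wᴴ) = 1 := by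
    rw [← Matrix.ext_iff, forall_comm]
    refine forall_congr' fun b => forall_congr' fun a => ?_
    have : (W * ((n : ℂ)⁻¹ • Wᴴ)) b a = (n : ℂ)⁻¹ * ((U a)ᴴ * U b).trace := by
      rw [Matrix.mul_smul, Matrix.smul_apply, smul_eq_mul, Matrix.mul_apply, Fintype.sum_prod_type,
        Finset.sum_comm]
      simp only [Matrix.trace, Matrix.diag, Matrix.mul_apply, Matrix.conjTranspose_apply, W,
        Matrix.of_apply]
      congr 1
      exact Finset.sum_congr rfl fun i _ => Finset.sum_congr rfl fun p _ => mul_comm _ _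
    rw [this, inv_mul_eq_iff_eq_mul₀ hn, Matrix.one_apply]
    simp [eq_comm]
  have h2 : ((n : ℂ)⁻¹ • Wᴴ) * W = 1 ↔
      ∀ p q i j, ∑ a, U a p i * star (U a q j) = if p = q ∧ i = j then (n : ℂ) else 0 := by
    have : ∀ p q i j, (((n : ℂ)⁻¹ • Wᴴ) * W) (q, j) (p, i) =
        (n : ℂ)⁻¹ * ∑ a, U a p i * star (U a q j) := by
      intro p q i j
      rw [Matrix.smul_mul, Matrix.smul_apply, smul_eq_mul, Matrix.mul_apply]
      simp only [Matrix.conjTranspose_apply, W, Matrix.of_apply]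
      congr 1
      exact Finset.sum_congr rfl fun i _ => mul_comm _ _
    have h3 : ∀ p q i j, (((n : ℂ)⁻¹ • Wᴴ) * W) (q, j) (p, i) =
        (1 : Matrix (Fin n × Fin n) (Fin n × Fin n) ℂ) (q, j) (p, i) ↔
        ∑ a, U a p i * star (U a q j) = if p = q ∧ i = j then (n : ℂ) else 0 := by
      intro p q i j
      rw [this, inv_mul_eq_iff_eq_mul₀ hn, Matrix.one_apply]
      simp [eq_comm, Prod.ext_iff]
    exact ⟨fun h p q i j => (h3 p q i j).mp (by rw [h]), fun h => by
      ext ⟨q, j⟩ ⟨p, i⟩; exact (h3 p q i j).mpr (h p q i j)⟩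
  rw [h1, ← h2]
  -- The cardinality hypothesis makes `W` square, so one-sided inverses are two-sided.
  have hc : Fintype.card ι = Fintype.card (Fin n × Fin n) := by simp [hcard, sq]
  exact Matrix.mul_eq_one_comm_of_equiv (Fintype.card_eq.mp hc).some

/-! ### Unitary projective representations and existence of the error basis -/

section ProjectiveRepresentation

variable {L : Type*} [Group L] [Fintype L] {ψ : TwoCocycle L} {n : ℕ}

/-- Weyl's unitary trick for projective representations. -/
theorem exists_unitary_conjugate {T : L → Matrix (Fin n) (Fin n) ℂ}
    (hT : ∀ a b, T a * T b = (ψ a b : ℂ) • T (a * b)) (h1 : IsUnit (T 1)) :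
    ∃ S : Matrix (Fin n) (Fin n) ℂ, IsUnit S.det ∧
      ∀ a, S * T a * S⁻¹ ∈ Matrix.unitaryGroup (Fin n) ℂ := by
  classical
  open scoped ComplexOrder in
  have hpos : (∑ a, (T a)ᴴ * T a).PosDef := by
    -- The summand at `1` is positive definite because `T 1` is invertible; semidefiniteness of the
    -- others suffices.
    rw [← Finset.add_sum_erase _ _ (Finset.mem_univ (1 : L))]
    exact (Matrix.PosDef.conjTranspose_mul_self _
      (Matrix.mulVec_injective_of_isUnit h1)).add_posSemidef
      (Matrix.posSemidef_sum _ fun a _ => Matrix.posSemidef_conjTranspose_mul_self _)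
  have hinv : ∀ b, (T b)ᴴ * (∑ a, (T a)ᴴ * T a) * T b = ∑ a, (T a)ᴴ * T a := by
    intro b
    rw [Matrix.mul_sum, Matrix.sum_mul]
    refine Fintype.sum_equiv (Equiv.mulRight b) _ _ fun a => ?_
    calc (T b)ᴴ * ((T a)ᴴ * T a) * T b = (T a * T b)ᴴ * (T a * T b) := by
          rw [Matrix.conjTranspose_mul]; simp only [Matrix.mul_assoc]
      _ = _ := by
          rw [hT, Matrix.conjTranspose_smul, Matrix.smul_mul, Matrix.mul_smul, smul_smul,
            Circle.star_coe_mul_self, one_smul]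
          rfl
  -- `S` carries the averaged, `L`-invariant inner product to the standard one.
  obtain ⟨S, hS⟩ : ∃ S : Matrix (Fin n) (Fin n) ℂ, (∑ a, (T a)ᴴ * T a) = Sᴴ * S := by
    open scoped ComplexOrder MatrixOrder in
    exact CStarAlgebra.nonneg_iff_eq_star_mul_self.mp hpos.posSemidef.nonneg
  have hSu : IsUnit S.det := by
    have h := (Matrix.isUnit_iff_isUnit_det _).mp hpos.isUnit
    rw [hS, Matrix.det_mul] at h
    exact isUnit_of_mul_isUnit_right h
  refine ⟨S, hSu, fun a => ?_⟩
  rw [Matrix.mem_unitaryGroup_iff', Matrix.star_eq_conjTranspose]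
  have h2 := hinv a
  rw [hS] at h2
  calc (S * T a * S⁻¹)ᴴ * (S * T a * S⁻¹) = (S⁻¹)ᴴ * ((T a)ᴴ * (Sᴴ * S) * T a) * S⁻¹ := by
        simp only [Matrix.conjTranspose_mul, Matrix.mul_assoc]
    _ = (S * S⁻¹)ᴴ * (S * S⁻¹) := by
        rw [h2]; simp only [Matrix.conjTranspose_mul, Matrix.mul_assoc]
    _ = 1 := by rw [Matrix.mul_nonsing_inv _ hSu]; simp

/-- The twirl over an irreducible projective unitary representation. -/
theorem sum_conj_eq_trace_smul {U : L → Matrix (Fin n) (Fin n) ℂ}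
    (hU : ∀ a, U a ∈ Matrix.unitaryGroup (Fin n) ℂ)
    (hmul : ∀ a b, U a * U b = (ψ a b : ℂ) • U (a * b))
    (hspan : ∀ M, ∃ f : L → ℂ, M = ∑ a, f a • U a) (hn : (n : ℂ) ≠ 0)
    (hcard : Fintype.card L = n ^ 2) (Y : Matrix (Fin n) (Fin n) ℂ) :
    ∑ a, U a * Y * (U a)ᴴ = ((n : ℂ) * Y.trace) • 1 := by
  have hstar : ∀ a, (U a)ᴴ * U a = 1 := fun a => Matrix.mem_unitaryGroup_iff'.mp (hU a)
  have hinv : ∀ b, U b * (∑ a, U a * Y * (U a)ᴴ) * (U b)ᴴ = ∑ a, U a * Y * (U a)ᴴ := by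
    intro b
    rw [Matrix.mul_sum, Matrix.sum_mul]
    refine Fintype.sum_equiv (Equiv.mulLeft b) _ _ fun a => ?_
    calc U b * (U a * Y * (U a)ᴴ) * (U b)ᴴ = (U b * U a) * Y * (U b * U a)ᴴ := by
          rw [Matrix.conjTranspose_mul]; simp only [Matrix.mul_assoc]
      _ = _ := by
          rw [hmul, Matrix.conjTranspose_smul]
          simp only [Matrix.smul_mul, Matrix.mul_smul, smul_smul]
          rw [Circle.star_coe_mul_self, one_smul]
          rfl
  obtain ⟨c, hc⟩ := Matrix.exists_eq_smul_one_of_commute hspan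
    (Z := ∑ a, U a * Y * (U a)ᴴ) fun b => by
      change U b * _ = _ * U b
      conv_rhs => rw [← hinv b, Matrix.mul_assoc, hstar, Matrix.mul_one]
  -- The scalar is found by comparing traces: `n² tr Y = c n`.
  have ht := congrArg Matrix.trace hc
  have h2 : ∀ a, (U a * Y * (U a)ᴴ).trace = Y.trace := fun a => by
    rw [Matrix.trace_mul_comm, ← Matrix.mul_assoc, hstar, Matrix.one_mul]
  simp only [Matrix.trace_sum, h2, Finset.sum_const, Finset.card_univ, hcard, Matrix.trace_smul,
    Matrix.trace_one, Fintype.card_fin, nsmul_eq_mul, smul_eq_mul] at ht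
  rw [hc]
  congr 1
  push_cast at ht
  exact mul_right_cancel₀ hn (by linear_combination -ht)

/-- Simplicity supplies both the representation and the count `|L| = n²`. Unitarity then comes from
averaging, and trace orthogonality from Schur's lemma. -/
theorem TwoCocycle.IsNondegenerate.exists_niceUEB (hψ : ψ.IsNondegenerate) :
    ∃ n : ℕ, Nonempty (NiceUEB ψ n) := by
  classical
  have : IsSimpleRing ψ.Algebra := hψ
  obtain ⟨n, hn, ⟨e⟩⟩ := IsSimpleRing.exists_algEquiv_matrix_of_isAlgClosed ℂ ψ.Algebra
  have hn0 : (n : ℂ) ≠ 0 := Nat.cast_ne_zero.mpr hn.out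
  have hcard : Fintype.card L = n ^ 2 := by
    rw [← Algebra.finrank_eq_card (ψ := ψ), e.toLinearEquiv.finrank_eq, Module.finrank_matrix]
    simp [sq]
  have hT : ∀ a b, e (Algebra.single ψ a) * e (Algebra.single ψ b) =
      (ψ a b : ℂ) • e (Algebra.single ψ (a * b)) := fun a b => by
    rw [← map_mul, Algebra.single_mul_single, map_smul]
  have h1 : IsUnit (e (Algebra.single ψ 1)) := by
    rw [Algebra.single_one, map_smul, map_one]
    exact isUnit_one.smul (Units.mk0 (ψ 1 1 : ℂ) (Circle.coe_ne_zero _))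
  obtain ⟨S, hS, hU⟩ := exists_unitary_conjugate hT h1
  have hmul : ∀ a b, (S * e (Algebra.single ψ a) * S⁻¹) * (S * e (Algebra.single ψ b) * S⁻¹) =
      (ψ a b : ℂ) • (S * e (Algebra.single ψ (a * b)) * S⁻¹) := fun a b => by
    calc _ = S * (e (Algebra.single ψ a) * (S⁻¹ * S) * e (Algebra.single ψ b)) * S⁻¹ := by
          simp only [Matrix.mul_assoc]
      _ = _ := by
          rw [Matrix.nonsing_inv_mul _ hS, Matrix.mul_one, hT, Matrix.mul_smul, Matrix.smul_mul]
  have hspan : ∀ M, ∃ f : L → ℂ, M = ∑ a, f a • (S * e (Algebra.single ψ a) * S⁻¹) := by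
    intro M
    obtain ⟨f, hf⟩ := Algebra.exists_eq_sum_single (e.symm (S⁻¹ * M * S))
    refine ⟨f, ?_⟩
    have h := congrArg e hf
    rw [AlgEquiv.apply_symm_apply] at h
    simp only [map_sum, map_smul] at h
    have h2 : ∀ f : L → ℂ, ∑ a, f a • (S * e (Algebra.single ψ a) * S⁻¹) =
        S * (∑ a, f a • e (Algebra.single ψ a)) * S⁻¹ := fun f => by
      simp only [Matrix.mul_sum, Matrix.sum_mul, Matrix.mul_smul, Matrix.smul_mul]
    rw [h2, ← h]
    have h' : S * (S⁻¹ * M * S) * S⁻¹ = (S * S⁻¹) * M * (S * S⁻¹) := by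
      simp only [Matrix.mul_assoc]
    rw [h', Matrix.mul_nonsing_inv _ hS, Matrix.one_mul, Matrix.mul_one]
  -- The completeness relation is the twirl of the matrix unit at `(i, j)`, read at the entry `(p,
  -- q)`.
  have htrace := (Matrix.trace_orthogonality_iff_completeness hn0 hcard
    (fun a => S * e (Algebra.single ψ a) * S⁻¹)).mpr fun p q i j => by
      have h := congrFun (congrFun
        (sum_conj_eq_trace_smul hU hmul hspan hn0 hcard (Matrix.single i j 1)) p) q
      rw [Matrix.sum_apply] at h
      simp only [Matrix.mul_single_mul_apply, Matrix.conjTranspose_apply] at h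
      rw [h]
      by_cases hij : i = j
      · subst hij; simp [Matrix.one_apply]
      · simp [hij]
  exact ⟨n, ⟨{
    U := fun a => S * e (Algebra.single ψ a) * S⁻¹
    unitary := hU
    card_eq := hcard
    trace_self := fun a => by rw [htrace, if_pos rfl]
    trace_ne := fun a b hab => by rw [htrace, if_neg hab]
    mul_eq := hmul }⟩⟩

end ProjectiveRepresentation

/-! ### Values at a vertex, stabiliser twirls and coisotropy -/

section Stabilisers

set_option linter.unusedSectionVars false

variable {V : Type*} [Fintype V] [DecidableEq V] {G : SimpleGraph V} {L : Subgroup (G ≃g G)}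
  [Fintype L] {ψ : TwoCocycle L} {n : ℕ}

namespace NiceUEB

theorem trace_conjTranspose_mul [DecidableEq L] (B : NiceUEB ψ n) (a b : L) :
    ((B.U a)ᴴ * B.U b).trace = if a = b then (n : ℂ) else 0 := by
  split_ifs with h
  · subst h; exact B.trace_self a
  · exact B.trace_ne a b h

/-- This is the completeness relation contracted with `M`; the factor `n` is the squared trace norm
of each `U_a`. -/
theorem sum_trace_smul_U (B : NiceUEB ψ n) (M : Matrix (Fin n) (Fin n) ℂ) :
    ∑ a, ((B.U a)ᴴ * M).trace • B.U a = (n : ℂ) • M := by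
  classical
  have h := (Matrix.trace_orthogonality_iff_completeness B.n_ne_zero B.card_eq B.U).mp
    B.trace_conjTranspose_mul
  ext p i
  have h1 : ∀ a, ((B.U a)ᴴ * M).trace * B.U a p i =
      ∑ j, ∑ q, (B.U a p i * star (B.U a q j)) * M q j := by
    intro a
    simp only [Matrix.trace, Matrix.diag, Matrix.mul_apply, Matrix.conjTranspose_apply,
      Finset.sum_mul]
    exact Finset.sum_congr rfl fun j _ => Finset.sum_congr rfl fun q _ => by ring
  simp only [Matrix.sum_apply, Matrix.smul_apply, smul_eq_mul, h1]
  rw [Finset.sum_comm]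
  simp only [Finset.sum_comm (s := (Finset.univ : Finset L)), ← Finset.sum_mul, h]
  rw [Finset.sum_eq_single i, Finset.sum_eq_single p]
  · simp
  · intro q _ hq; simp [Ne.symm hq]
  · simp
  · intro j _ hj; simp [Ne.symm hj]
  · simp

/-- For commuting elements `ghg⁻¹ = h`, so `ρ_ψ(g,h)` reduces to `ψ(g,h) ψ(h,g)⁻¹`, the commutation
phase. This is how the cocycle condition defining `S^⊥` becomes a statement about operators. -/
theorem U_mul_U_of_commute (B : NiceUEB ψ n) {g h : L} (hgh : g * h = h * g) :
    B.U g * B.U h = (ψ.rho g h : ℂ) • (B.U h * B.U g) := by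
  rw [B.mul_eq, B.mul_eq, smul_smul, TwoCocycle.rho, hgh, mul_inv_cancel_right,
    ← Circle.coe_mul, inv_mul_cancel_right]

open Classical in
/-- The twirl of a matrix over the stabiliser of a vertex. -/
def stabiliserTwirl (B : NiceUEB ψ n) (v : V) (Y : Matrix (Fin n) (Fin n) ℂ) :
    Matrix (Fin n) (Fin n) ℂ :=
  ∑ a : L, if a ∈ vertexStabiliser L v then B.U a * Y * (B.U a)ᴴ else 0

/-- The stabiliser twirls at a vertex are components of elements of the vertex algebra. -/
theorem exists_comp_eq_stabiliserTwirl (B : NiceUEB ψ n) (v : V)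
    (Y : Matrix (Fin n) (Fin n) ℂ) :
    ∃ F : B.Space, comp (F : EuclideanSpace ℂ (Fin n × V × Fin n)) v = B.stabiliserTwirl v Y := by
  -- The equivariant extension of the twirl: it is supported on the orbit of `v`, and its
  -- equivariance is the reindexing `a ↦ ba`.
  let T : V → Matrix (Fin n) (Fin n) ℂ := fun w =>
    ∑ a : L, if (a : G ≃g G) v = w then B.U a * Y * (B.U a)ᴴ else 0
  let F : EuclideanSpace ℂ (Fin n × V × Fin n) := WithLp.toLp 2 fun x => T x.2.1 x.2.2 x.1
  have hF : ∀ w, comp F w = T w := fun w => rfl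
  refine ⟨⟨F, B.mem_space_iff.mpr fun b w => ?_⟩, ?_⟩
  · rw [hF, hF, Matrix.mul_sum, Matrix.sum_mul]
    refine (Fintype.sum_equiv (Equiv.mulLeft b) _ _ fun a => ?_).symm
    simp only [Equiv.coe_mulLeft, Subgroup.coe_mul, RelIso.mul_apply, EmbeddingLike.apply_eq_iff_eq]
    split_ifs
    · rw [conj_mul_conj]
    · simp
  · change T v = _
    refine Finset.sum_congr rfl fun a _ => ?_
    by_cases h : (a : G ≃g G) v = v
    · rw [if_pos h, if_pos (show a ∈ vertexStabiliser L v from h)]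
    · rw [if_neg h, if_neg (show a ∉ vertexStabiliser L v from h)]

/-- A matrix commuting with all twirls over a stabiliser lies in the span of the error basis
elements of the stabiliser. -/
theorem trace_eq_zero_of_commute_stabiliserTwirl (B : NiceUEB ψ n) {v : V}
    {M : Matrix (Fin n) (Fin n) ℂ} (hM : ∀ Y, Commute M (B.stabiliserTwirl v Y)) {g : L}
    (hg : g ∉ vertexStabiliser L v) : ((B.U g)ᴴ * M).trace = 0 := by
  classical
  -- Commutation with the twirls of all matrix units is contracted over one index: the entry `(p,
  -- j)` of the identity for the unit at `(i, j)` is summed over `j`.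
  have h1 : ∑ a : L, (if a ∈ vertexStabiliser L v then (star (B.U a).trace) • (M * B.U a) else 0) =
      ∑ a : L, if a ∈ vertexStabiliser L v then ((B.U a)ᴴ * M).trace • B.U a else 0 := by
    ext p i
    have h2 : ∀ j, ∑ a : L, (if a ∈ vertexStabiliser L v then
        (M * B.U a) p i * star (B.U a j j) else 0) =
        ∑ a : L, if a ∈ vertexStabiliser L v then B.U a p i * ((B.U a)ᴴ * M) j j else 0 := by
      intro j
      have h3 := congrFun (congrFun (hM (Matrix.single i j 1)).eq p) j
      simp only [stabiliserTwirl, Matrix.mul_sum, Matrix.sum_mul, mul_ite, ite_mul, mul_zero,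
        zero_mul] at h3
      rw [Matrix.sum_apply, Matrix.sum_apply] at h3
      refine Eq.trans (Finset.sum_congr rfl fun a _ => ?_)
        (h3.trans (Finset.sum_congr rfl fun a _ => ?_))
      · split_ifs
        · rw [← Matrix.mul_assoc, ← Matrix.mul_assoc, Matrix.mul_single_mul_apply,
            Matrix.conjTranspose_apply]
        · rfl
      · split_ifs
        · rw [Matrix.mul_assoc, Matrix.mul_single_mul_apply]
        · rfl
    have h4 := Finset.sum_congr rfl fun (j : Fin n) (_ : j ∈ Finset.univ) => h2 j
    rw [Finset.sum_comm, Finset.sum_comm (s := (Finset.univ : Finset (Fin n)))] at h4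
    rw [Matrix.sum_apply, Matrix.sum_apply]
    refine Eq.trans (Finset.sum_congr rfl fun a _ => ?_)
        (h4.trans (Finset.sum_congr rfl fun a _ => ?_))
    · split_ifs
      · rw [← Finset.mul_sum, Matrix.smul_apply, Matrix.trace, star_sum, smul_eq_mul, mul_comm]
        rfl
      · simp
    · split_ifs
      · rw [← Finset.mul_sum, Matrix.smul_apply, Matrix.trace, smul_eq_mul, mul_comm]
        rfl
      · simp
  have h1mem : (1 : L) ∈ vertexStabiliser L v := rfl
  -- Since `tr U_a = 0` for `a ≠ 1`, the left side collapses to `n M`, the phase of `U_1` cancelling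
  -- against that of its conjugate trace. Thus `n M` is expanded using the stabiliser alone.
  rw [Finset.sum_eq_single 1 (fun a _ ha => by simp [B.trace_U a ha]) (by simp), if_pos h1mem,
    U_one, Matrix.trace_smul, Matrix.mul_smul, Matrix.mul_one, smul_smul, Matrix.trace_one,
    Fintype.card_fin, smul_eq_mul, star_mul', mul_right_comm, Circle.star_coe_mul_self, one_mul,
    star_natCast] at h1
  -- Pairing with `U_g` annihilates that expansion, because `g` is outside the stabiliser.
  have h5 := congrArg (fun X => ((B.U g)ᴴ * X).trace) h1
  simp only [Matrix.mul_smul, Matrix.trace_smul, Matrix.mul_sum, Matrix.trace_sum, mul_ite,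
    mul_zero, smul_eq_mul] at h5
  refine (mul_eq_zero.mp (h5.trans (Finset.sum_eq_zero fun a _ => ?_))).resolve_left B.n_ne_zero
  split_ifs with ha
  · have hga : g ≠ a := fun h => hg (h ▸ ha)
    rw [Matrix.trace_smul, B.trace_ne g a hga, smul_zero]
  · exact Matrix.trace_zero _ _

/-- No cancellation can occur. A stabiliser element commuting with `g` contributes exactly `n`, its
phase being `1` because `g ∈ S^⊥`; any other one sends `U_g` to a multiple of the orthogonal
`U_{aga⁻¹}` and contributes `0`. The identity element makes the count positive. -/
theorem trace_stabiliserTwirl_ne_zero (B : NiceUEB ψ n) {v : V} {g : L}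
    (hg : g ∈ ψ.orthogonalComplement (vertexStabiliser L v)) :
    ((B.U g)ᴴ * B.stabiliserTwirl v (B.U g)).trace ≠ 0 := by
  classical
  have hterm : ∀ a : L, ((B.U g)ᴴ * (if a ∈ vertexStabiliser L v then
      B.U a * B.U g * (B.U a)ᴴ else 0)).trace =
      if a ∈ vertexStabiliser L v ∧ a * g = g * a then (n : ℂ) else 0 := by
    intro a
    by_cases ha : a ∈ vertexStabiliser L v
    · rw [if_pos ha]
      by_cases hag : a * g = g * a
      · have h := B.U_mul_U_of_commute hag.symm
        rw [hg a ha hag, Circle.coe_one, one_smul] at h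
        rw [← h, Matrix.mul_assoc, U_mul_star, Matrix.mul_one, B.trace_self, if_pos ⟨ha, hag⟩]
      · rw [if_neg fun h => hag h.2]
        have h := B.mul_eq (a * g * a⁻¹) a
        rw [inv_mul_cancel_right] at h
        have h2 : B.U a * B.U g * (B.U a)ᴴ =
            ((ψ a g : ℂ) * (ψ (a * g * a⁻¹) a : ℂ)⁻¹) • B.U (a * g * a⁻¹) := by
          rw [B.mul_eq, mul_smul, ← Matrix.mul_one (B.U (a * g * a⁻¹)), ← B.U_mul_star a,
            ← Matrix.mul_assoc, h, Matrix.smul_mul, Matrix.smul_mul,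
            inv_smul_smul₀ (Circle.coe_ne_zero _)]
        have hne : g ≠ a * g * a⁻¹ := fun h => hag (eq_mul_inv_iff_mul_eq.mp h).symm
        rw [h2, Matrix.mul_smul, Matrix.trace_smul, B.trace_ne _ _ hne, smul_zero]
    · rw [if_neg ha, if_neg fun h => ha h.1, Matrix.mul_zero, Matrix.trace_zero]
  rw [stabiliserTwirl, Matrix.mul_sum, Matrix.trace_sum, Finset.sum_congr rfl fun a _ => hterm a,
    ← Finset.sum_filter, Finset.sum_const, nsmul_eq_mul]
  refine mul_ne_zero (Nat.cast_ne_zero.mpr (Finset.card_ne_zero_of_mem (a := (1 : L)) ?_))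
    B.n_ne_zero
  exact Finset.mem_filter.mpr ⟨Finset.mem_univ _, rfl, by simp⟩

/-- Multiplication is pointwise up to the nonzero scalar `√n` and a reversal of order, so
commutativity can be tested at each vertex. -/
theorem isClassical_iff_comp [DecidableRel G.Adj] (B : NiceUEB ψ n) :
    B.quantumGraph.IsClassical ↔ ∀ (F K : B.Space) (v : V),
      Commute (comp (F : EuclideanSpace ℂ (Fin n × V × Fin n)) v)
        (comp (K : EuclideanSpace ℂ (Fin n × V × Fin n)) v) := by
  have hs : ((Real.sqrt n : ℝ) : ℂ) ≠ 0 := fun h =>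
    B.n_ne_zero (by rw [← sqrt_mul_sqrt (n := n), h, zero_mul])
  change (∀ F K : B.Space, B.mul (F ⊗ₜ K) = B.mul (K ⊗ₜ F)) ↔ _
  refine forall_congr' fun F => forall_congr' fun K => ⟨fun h v => ?_, fun h => ?_⟩
  · have h1 := congrArg
      (fun M : B.Space => comp (M : EuclideanSpace ℂ (Fin n × V × Fin n)) v) h
    simp only [comp_mul] at h1
    exact (smul_right_injective _ hs h1).symm
  · exact B.space_ext fun v => by rw [comp_mul, comp_mul, (h v).eq]

/-- Equivariance at a fixed point of `a` says that conjugation by `U_a` fixes the value there. -/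
theorem U_mul_comp (B : NiceUEB ψ n) (F : B.Space) {v : V} {a : L}
    (ha : a ∈ vertexStabiliser L v) :
    Commute (B.U a) (comp (F : EuclideanSpace ℂ (Fin n × V × Fin n)) v) := by
  have h := B.comp_covariant F a v
  rw [show (a : G ≃g G) v = v from ha] at h
  change _ = _ * B.U a
  conv_rhs => rw [h, Matrix.mul_assoc, star_mul_U, Matrix.mul_one]

/-- The components at a vertex with coisotropic stabiliser lie in the span of the error basis
elements of the stabiliser. -/
theorem trace_comp_eq_zero (B : NiceUEB ψ n) (F : B.Space) {v : V}
    (hv : ψ.IsCoisotropic (vertexStabiliser L v)) {g : L} (hg : g ∉ vertexStabiliser L v) :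
    ((B.U g)ᴴ * comp (F : EuclideanSpace ℂ (Fin n × V × Fin n)) v).trace = 0 := by
  -- Coisotropy in contrapositive form: `g` lies outside `S^⊥`, and a witness `a` is extracted.
  have hg' : ¬ ∀ a ∈ vertexStabiliser L v, a * g = g * a → ψ.rho g a = 1 := fun h => hg (hv h)
  push Not at hg'
  obtain ⟨a, ha, hag, hne⟩ := hg'
  set M := comp (F : EuclideanSpace ℂ (Fin n × V × Fin n)) v
  have hM : B.U a * M = M * B.U a := (B.U_mul_comp F ha).eq
  have h1 := B.U_mul_U_of_commute hag.symm
  -- conjugation by `U a` preserves `M` and multiplies `U g` by a phase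
  have h2 : ((B.U g)ᴴ * M).trace = star (ψ.rho g a : ℂ) * ((B.U g)ᴴ * M).trace := by
    calc ((B.U g)ᴴ * M).trace = ((B.U g)ᴴ * M * (B.U a * (B.U a)ᴴ)).trace := by
          rw [U_mul_star, Matrix.mul_one]
      _ = ((B.U a)ᴴ * ((B.U g)ᴴ * (M * B.U a))).trace := by
          rw [← Matrix.mul_assoc, Matrix.trace_mul_comm, Matrix.mul_assoc (B.U g)ᴴ]
      _ = ((B.U g * B.U a)ᴴ * (B.U a * M)).trace := by
          rw [← hM, Matrix.conjTranspose_mul, Matrix.mul_assoc]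
      _ = star (ψ.rho g a : ℂ) * ((B.U g)ᴴ * ((B.U a)ᴴ * B.U a) * M).trace := by
          rw [h1, Matrix.conjTranspose_smul, Matrix.smul_mul, Matrix.trace_smul, smul_eq_mul,
            Matrix.conjTranspose_mul]
          simp only [Matrix.mul_assoc]
      _ = _ := by rw [star_mul_U, Matrix.mul_one]
  by_contra h0
  have h3 : star (ψ.rho g a : ℂ) = 1 :=
    mul_right_cancel₀ h0 (by rw [one_mul]; exact h2.symm)
  refine hne (Circle.ext ?_)
  rw [Circle.coe_one, ← star_star (ψ.rho g a : ℂ), h3, star_one]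

theorem isClassical_iff_isCoisotropic [DecidableRel G.Adj] (B : NiceUEB ψ n) :
    B.quantumGraph.IsClassical ↔ ∀ v : V, ψ.IsCoisotropic (vertexStabiliser L v) := by
  rw [isClassical_iff_comp]
  constructor
  · intro hcomm v g hg
    by_contra hgv
    -- For `g ∈ S^⊥` outside `S`, the twirl of `U_g` would have both zero and nonzero coefficient at
    -- `U_g`.
    obtain ⟨F, hF⟩ := B.exists_comp_eq_stabiliserTwirl v (B.U g)
    refine B.trace_stabiliserTwirl_ne_zero hg
      (B.trace_eq_zero_of_commute_stabiliserTwirl (fun Y => ?_) hgv)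
    obtain ⟨K, hK⟩ := B.exists_comp_eq_stabiliserTwirl v Y
    rw [← hF, ← hK]
    exact hcomm F K v
  · intro hco F K v
    have h := B.sum_trace_smul_U (comp (F : EuclideanSpace ℂ (Fin n × V × Fin n)) v)
    -- Only `F(v)` is expanded in the error basis: terms from the stabiliser commute with `K(v)`,
    -- and the others vanish by coisotropy.
    rw [← inv_smul_smul₀ B.n_ne_zero (comp (F : EuclideanSpace ℂ (Fin n × V × Fin n)) v), ← h]
    refine (Commute.sum_left _ _ _ fun a _ => ?_).smul_left _
    by_cases ha : a ∈ vertexStabiliser L v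
    · exact (B.U_mul_comp K ha).smul_left _
    · rw [B.trace_comp_eq_zero F (hco v) ha, zero_smul]
      exact Commute.zero_left _

end NiceUEB

end Stabilisers

end

theorem mainTheorem7 {V : Type*} [Fintype V] [DecidableEq V] (G : SimpleGraph V)
    [DecidableRel G.Adj] (L : Subgroup (G ≃g G)) [Fintype L] (ψ : TwoCocycle L)
    (hψ : ψ.IsNondegenerate) :
    (∃ n : ℕ, Nonempty (NiceUEB ψ n)) ∧
      ∀ (n : ℕ) (B : NiceUEB ψ n),
        B.quantumGraph.IsClassical ↔ ∀ v : V, ψ.IsCoisotropic (vertexStabiliser L v) :=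
  ⟨hψ.exists_niceUEB, fun _ B => B.isClassical_iff_isCoisotropic⟩
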